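/- Let $1\le N\le M$ be integers. For $\mathbf z=(z_1,\dots,z_N)\in\mathbb C^N$ and a Young diagram $\lambda\subseteq (M-N)^N$, i.e. $M-N\ge\lambda_1\ge\dots\ge\lambda_N\ge 0$, let $$G_\lambda(\mathbf z;\beta)=\frac{\det_{1\le j,k\le N}\bigl(z_j^{\lambda_k+N-k}(1+\beta z_j)^{k-1}\bigr)}{\prod_{1\le j<k\le N}(z_j-z_k)}$$ be the Grothendieck polynomial. On the quantum space $(\mathbb C^2)^{\otimes M}$ of a periodic lattice with sites $\mathbb Z/M\mathbb Z$, where each factor has the basis $|0\rangle$ (empty), $|1\rangle$ (occupied), let $s_i$ be the projection onto $|0\rangle$ at site $i$ (indices modulo $M$), and let $|x_1\cdots x_N\rangle$ be the basis vector with particles exactly at the sites $1\le x_1<\dots<x_N\le M$. For an operator $\mathcal A$ and $\mu,\nu\subseteq(M-N)^N$ put $\mathcal A_\mu^\nu=\langle y_1\cdots y_N|\mathcal A|x_1\cdots x_N\rangle$ with $x_j=\mu_{N-j+1}+j$ and $y_j=\nu_{N-j+1}+j$. Let $l\in\mathbb Z$ and let $n\ge 0$ be an integer with $-l+1\le n\le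 M$, and let $\mathcal A=s_l s_{l+1}\cdots s_{l+n-1}$ (the identity if $n=0$). Consider $$\sum_{\nu\subseteq(M-N)^N}\ \sum_{\mu\subseteq(M-N)^N}\mathcal A_\mu^\nu\,G_\mu(\mathbf z;-1)=\prod_{j=1}^N z_j^{\,l+n-1}\prod_{1\le j<k\le N}\frac1{z_k-z_j}\ \det\bigl(V^{(M-n)}_{jk}\bigr)_{1\le j,k\le N},\qquad(*)$$ where $$V^{(M-n)}_{jk}=\sum_{m=0}^{j-1}(-1)^m\binom{M-n}{m}(1-z_k)^{m-j+N-1}\quad(1\le j\le N-1),$$ $$V^{(M-n)}_{Nk}=-\sum_{m=\max(N-1,1)}^{M-n}(-1)^m\binom{M-n}{m}(1-z_k)^{m-1}.$$ 1. If $l\le 1$, then $(*)$ holds for arbitrary pairwise distinct $z_1,\dots,z_N\in\mathbb C$. For $l\ge 2$, $(*)$ holds for all pairwise distinct nonzero $z_1,\dots,z_N\in\mathbb C$ that satisfy the Bethe ansatz equations of the periodic TASEP, $z_k^{-M}(1-z_k)^N=(-1)^{N-1}\prod_{j=1}^N(1-z_j)$ for $1\le k\le N$. 2. If $l\le 1$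 and $\mathbf z\in\mathbb C^N$ is arbitrary (coordinates may coincide), or if $l$ is arbitrary and $\mathbf z=(1,\dots,1)$, then the two sides of $(*)$, as functions of points $\mathbf w$ with pairwise distinct coordinates, have limits as $\mathbf w\to\mathbf z$, and these limits are equal. -/

import Mathlib

open Filter Topology

namespace VacancyTASEP

/-- The Young diagrams `M - N ≥ lam 0 ≥ lam 1 ≥ ⋯ ≥ lam (N - 1) ≥ 0` with `N` rows that are contained
in the `N × (M - N)` rectangle. -/
def boxDiagrams (M N : ℕ) : Finset (Fin N → Fin (M - N + 1)) :=
  {lam | Antitone lam}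

/-- The Grothendieck polynomial
`G_lam(z; β) = det (z_j ^ (lam_k + N - k) * (1 + β z_j) ^ (k - 1)) / ∏_{j < k} (z_j - z_k)`
evaluated at `z` (indices start at `0` here, so that `k - 1` becomes `k`). -/
noncomputable def grothendieck {N K : ℕ} (β : ℂ) (lam : Fin N → Fin K) (z : Fin N → ℂ) : ℂ :=
  (Matrix.of fun j k : Fin N =>
      z j ^ ((lam k : ℕ) + (N - 1 - (k : ℕ))) * (1 + β * z j) ^ (k : ℕ)).det /
    ∏ j : Fin N, ∏ k ∈ Finset.Ioi j, (z j - z k)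

/-- Labels of the standard basis of the quantum space `(ℂ²)^{⊗ M}` of the periodic lattice with
sites `ZMod M` (the site `M` is the class of `0`); the value `0` is an empty site and
`1` an occupied one. -/
abbrev Config (M : ℕ) : Type := ZMod M → Fin 2

/-- Operators on `(ℂ²)^{⊗ M}`, as matrices in the standard basis:
the entry `A σ τ` is the matrix element `⟨σ| A |τ⟩`. -/
abbrev Operator (M : ℕ) : Type := Matrix (Config M) (Config M) ℂ

/-- The one-site projection `s = (1 + σᶻ) / 2` onto the empty state `|0⟩`. -/
def vacancy : Matrix (Fin 2) (Fin 2) ℂ := !![1, 0; 0, 0]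

/-- The operator that acts by `a` on the tensor factor at site `i` and by the identity on
all the others. -/
def siteOperator {M : ℕ} [NeZero M] (a : Matrix (Fin 2) (Fin 2) ℂ) (i : ZMod M) : Operator M :=
  fun σ τ => a (σ i) (τ i) * ∏ k ∈ Finset.univ.erase i, if σ k = τ k then 1 else 0

/-- The product `s_l s_{l+1} ⋯ s_{l+n-1}` of `n` vacancy projections, the site indices being
integers modulo `M`; it is the identity for `n = 0`. -/
def vacancyString (M : ℕ) [NeZero M] (l : ℤ) (n : ℕ) : Operator M :=
  ((List.range n).map fun i : ℕ => siteOperator vacancy ((l + (i : ℤ) : ℤ) : ZMod M)).prod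

/-- The position `x_j = lam_{N-j+1} + j` of the `j`-th particle, `1 ≤ j ≤ N`
(with `j - 1` as the index). -/
def position {N K : ℕ} (lam : Fin N → Fin K) (j : Fin N) : ℕ :=
  (lam j.rev : ℕ) + (j : ℕ) + 1

/-- The label of the basis vector `|x_1 ⋯ x_N⟩` given by the Young diagram `lam`. -/
def diagramConfig (M : ℕ) {N K : ℕ} (lam : Fin N → Fin K) : Config M :=
  fun i => if ∃ j : Fin N, ((position lam j : ℕ) : ZMod M) = i then 1 else 0

/-- The matrix element `A_mu^nu = ⟨y_1 ⋯ y_N| A |x_1 ⋯ x_N⟩`, with `x` given by `mu` and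
`y` given by `nu`. -/
def matrixElement {M N K : ℕ} (A : Operator M) (nu mu : Fin N → Fin K) : ℂ :=
  A (diagramConfig M nu) (diagramConfig M mu)

/-- The sum `∑_nu ∑_mu A_mu^nu G_mu(z; -1)` over `mu, nu ⊆ (M - N)^N`. -/
noncomputable def formFactorSum {M N : ℕ} (A : Operator M) (z : Fin N → ℂ) : ℂ :=
  ∑ nu ∈ boxDiagrams M N, ∑ mu ∈ boxDiagrams M N,
    matrixElement A nu mu * grothendieck (-1) mu z

/-- The matrix `V^{(L)}`. With row index `j` starting at `0`, its entries are
`∑_{m=0}^{j} (-1)^m binom(L, m) (1 - z_k)^(m - (j + 1) + N - 1)` in the rows `j + 1 ≤ N - 1`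
and `- ∑_{m = max(N-1, 1)}^{L} (-1)^m binom(L, m) (1 - z_k)^(m - 1)` in the last row.
No exponent is negative. -/
def matrixV {N : ℕ} (L : ℕ) (z : Fin N → ℂ) : Matrix (Fin N) (Fin N) ℂ :=
  Matrix.of fun j k =>
    if (j : ℕ) + 1 ≤ N - 1 then
      ∑ m ∈ Finset.range ((j : ℕ) + 1),
        (-1 : ℂ) ^ m * (L.choose m : ℂ) * (1 - z k) ^ (m + (N - 1) - ((j : ℕ) + 1))
    else
      -∑ m ∈ Finset.Icc (max (N - 1) 1) L,
        (-1 : ℂ) ^ m * (L.choose m : ℂ) * (1 - z k) ^ (m - 1)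

/-- The product
`∏_j z_j ^ (l + n - 1) * ∏_{j < k} 1 / (z_k - z_j) * det V^{(M - n)}`. -/
noncomputable def determinantSide {N : ℕ} (M : ℕ) (l : ℤ) (n : ℕ) (z : Fin N → ℂ) : ℂ :=
  (∏ j : Fin N, z j ^ (l + (n : ℤ) - 1)) *
    (∏ j : Fin N, ∏ k ∈ Finset.Ioi j, 1 / (z k - z j)) * (matrixV (M - n) z).det

/-- The Bethe ansatz equations of the periodic TASEP:
`z_k ^ (-M) * (1 - z_k) ^ N = (-1) ^ (N - 1) * ∏_j (1 - z_j)` for all `k`, with `z_k ≠ 0`. -/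
def BetheEquations {N : ℕ} (M : ℕ) (z : Fin N → ℂ) : Prop :=
  ∀ k : Fin N, z k ≠ 0 ∧
    (z k ^ M)⁻¹ * (1 - z k) ^ N = (-1) ^ (N - 1) * ∏ j : Fin N, (1 - z j)

end VacancyTASEP

/-! The vacancy string is diagonal, so the double sum collapses to a sum of alternant ratios over
the configurations avoiding the sites `l, …, l + n - 1`. A configuration is recorded by its
exponents `y k = lam k + N - 1 - k`, a strictly decreasing tuple below `M`, one less than the
particle positions.

For `l ≤ 1` the allowed exponents form one interval `[a, a + M - n)` with `a = l + n - 1`.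
Translating by `a` produces `(∏ z_j) ^ a` and leaves all strictly decreasing tuples below `L = M -
n`. With `v k y = z ^ y * (1 - z) ^ k` one has `v (k + 1) y = v k y - v k (y + 1)`, so summing an
entry below its larger neighbour telescopes to `v k 0` minus a copy of the neighbouring column,
which the determinant kills (`sum_strictAntiTuples_alternating`). What survives is the determinant
with rows `∑_{y < L} z ^ y, 1, 1 - z, …`. Expanding the geometric sum in powers of `1 - z` and
applying unitriangular row operations turns it into `matrixV` (`det_matrixV`).

For `l ≥ 2`, rotating the lattice by one site maps the vacant configurations for `l` to those for `l
+ 1`. The Bethe equations are what makes each ratio gain the factor `∏ z_j` under rotation,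
including when a particle wraps around (`BetheEquations.alternantRatio_rotate`); the right-hand side
gains the same factor.

For coinciding coordinates, Newton interpolation divides the Vandermonde product out of the
alternant, so each ratio is a polynomial, with value `1` at `(1, …, 1)`
(`exists_alternantRatio_eq_eval`). There both sides tend to a number of configurations, which
rotation preserves. -/

namespace VacancyTASEP

/-! ### Telescoping of alternating sums over decreasing tuples -/

/-- The strictly decreasing `N`-tuples of natural numbers below `L`. -/
def strictAntiTuples (N L : ℕ) : Finset (Fin N → ℕ) :=
  {y ∈ Fintype.piFinset fun _ : Fin N => Finset.range L | StrictAnti y}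

theorem mem_strictAntiTuples {N L : ℕ} {y : Fin N → ℕ} :
    y ∈ strictAntiTuples N L ↔ (∀ k, y k < L) ∧ StrictAnti y := by
  simp [strictAntiTuples, Fintype.mem_piFinset]

theorem strictAnti_cons_iff {N Y : ℕ} {y : Fin N → ℕ} :
    StrictAnti (Fin.cons Y y : Fin (N + 1) → ℕ) ↔ (∀ k, y k < Y) ∧ StrictAnti y := by
  constructor
  · intro h
    refine ⟨fun k => by simpa using h (Fin.succ_pos k), fun a b hab => ?_⟩
    simpa using h (Fin.succ_lt_succ_iff.2 hab)
  · rintro ⟨h0, h⟩ a b hab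
    induction b using Fin.cases with
    | zero => exact absurd hab (Fin.not_lt_zero a)
    | succ b =>
      induction a using Fin.cases with
      | zero => simpa using h0 b
      | succ a => simpa using h (Fin.succ_lt_succ_iff.1 hab)

theorem sum_strictAntiTuples_succ {A : Type*} [AddCommMonoid A] (N L : ℕ)
    (f : (Fin (N + 1) → ℕ) → A) :
    ∑ y ∈ strictAntiTuples (N + 1) L, f y =
      ∑ Y ∈ Finset.range L, ∑ y ∈ strictAntiTuples N Y, f (Fin.cons Y y) := by
  rw [Finset.sum_sigma']
  refine Finset.sum_bij' (fun y _ => ⟨y 0, Fin.tail y⟩) (fun p _ => Fin.cons p.1 p.2) ?_ ?_ ?_ ?_ ?_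
  · intro y hy
    rw [mem_strictAntiTuples] at hy
    obtain ⟨hL, hy⟩ := hy
    rw [← Fin.cons_self_tail y, strictAnti_cons_iff] at hy
    simp [mem_strictAntiTuples, hy, hL]
  · rintro ⟨Y, y⟩ h
    simp only [Finset.mem_sigma, Finset.mem_range, mem_strictAntiTuples] at h
    rw [mem_strictAntiTuples, strictAnti_cons_iff]
    refine ⟨fun k => ?_, h.2⟩
    induction k using Fin.cases with
    | zero => simpa using h.1
    | succ k => simpa using (h.2.1 k).trans h.1
  · intro y _; simp
  · intro p _; simp
  · intro y _; simp

theorem strictAntiTuples_zero (L : ℕ) : strictAntiTuples 0 L = {Fin.elim0} := by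
  ext y
  simp [mem_strictAntiTuples, Subsingleton.elim y Fin.elim0, StrictAnti]

/-- A telescoping sum over strictly decreasing sequences of an alternating map. -/
theorem sum_strictAntiTuples_alternating {R V W : Type*} [CommRing R] [AddCommGroup V] [Module R V]
    [AddCommGroup W] [Module R W] (N L : ℕ) (F : V [⋀^Fin (N + 1)]→ₗ[R] W) (v : ℕ → ℕ → V)
    (hv : ∀ k y, v (k + 1) y = v k y - v k (y + 1)) :
    ∑ y ∈ strictAntiTuples (N + 1) L, F (fun k => v k (y k)) =
      F (Fin.cons (∑ y ∈ Finset.range L, v 0 y) fun k : Fin N => v k 0) := by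
  induction N generalizing v L with
  | zero =>
    have h : ∀ x : V, (Fin.cons x (fun k : Fin 0 => v k 0) : Fin 1 → V) =
        Function.update (0 : Fin 1 → V) 0 x := by
      intro x
      funext k
      obtain rfl : k = 0 := Fin.fin_one_eq_zero k
      simp
    rw [sum_strictAntiTuples_succ, h, AlternatingMap.map_update_sum]
    refine Finset.sum_congr rfl fun Y _ => ?_
    rw [strictAntiTuples_zero, Finset.sum_singleton, ← h]
    congr 1
    funext k
    obtain rfl : k = 0 := Fin.fin_one_eq_zero k
    simp
  | succ N ih =>
    -- With the largest entry fixed at `Y`, the other slots form a shorter instance for the sequence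
    -- `v (k + 1)`.
    have key : ∀ Y, ∑ y ∈ strictAntiTuples (N + 1) Y,
        F (fun k => v k ((Fin.cons Y y : Fin (N + 2) → ℕ) k)) =
        F (Fin.cons (v 0 Y) fun k : Fin (N + 1) => v k 0) := by
      intro Y
      have h1 := ih Y (F.curryLeft (v 0 Y)) (fun k => v (k + 1)) (fun k => hv (k + 1))
      have h2 : ∀ y : Fin (N + 1) → ℕ, (fun k : Fin (N + 2) => v k ((Fin.cons Y y : Fin (N + 2) → ℕ) k)) =
          Fin.cons (v 0 Y) (fun k : Fin (N + 1) => v (k + 1) (y k)) := by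
        intro y
        funext k
        induction k using Fin.cases <;> simp
      simp only [h2]
      simp only [AlternatingMap.curryLeft_apply_apply, Matrix.vecCons] at h1
      rw [h1]
      have h3 : ∑ y ∈ Finset.range Y, v (0 + 1) y = v 0 0 - v 0 Y := by
        simp only [hv]; exact Finset.sum_range_sub' _ _
      rw [h3]
      have h4 : ∀ x : V, (Fin.cons (v 0 Y) (Fin.cons x fun k : Fin N => v (k + 1) 0) :
          Fin (N + 2) → V) = Function.update
            (Fin.cons (v 0 Y) (Fin.cons 0 fun k : Fin N => v (k + 1) 0)) 1 x := by
        intro x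
        funext k
        induction k using Fin.cases with
        | zero => simp
        | succ k =>
          induction k using Fin.cases with
          | zero => simp
          | succ k => rw [Function.update_of_ne]; · simp
                      · simp [Fin.ext_iff]
      -- The upper end of the telescope repeats the entry `v 0 Y`, so it contributes nothing.
      have h5 : F (Fin.cons (v 0 Y) (Fin.cons (v 0 Y) fun k : Fin N => v (k + 1) 0)) = 0 :=
        F.map_eq_zero_of_eq _ (i := 0) (j := 1) (by
          rw [Fin.cons_zero, show (1 : Fin (N + 2)) = Fin.succ 0 from rfl, Fin.cons_succ,
            Fin.cons_zero]) (by simp)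
      rw [h4, AlternatingMap.map_update_sub, ← h4, ← h4, h5, sub_zero]
      congr 2
      funext k
      induction k using Fin.cases <;> simp
    rw [sum_strictAntiTuples_succ, Finset.sum_congr rfl fun Y _ => key Y]
    have h : ∀ x : V, (Fin.cons x (fun k : Fin (N + 1) => v k 0) : Fin (N + 2) → V) =
        Function.update (Fin.cons 0 (fun k : Fin (N + 1) => v k 0)) 0 x := by
      intro x; simp
    rw [h (∑ y ∈ Finset.range L, v 0 y), AlternatingMap.map_update_sum]
    exact Finset.sum_congr rfl fun Y _ => by rw [← h]

/-! ### Alternants and the determinant of `matrixV` -/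

/-- The matrix `z_j ^ y_k * (1 - z_j) ^ k` whose determinant is the numerator of a Grothendieck
polynomial at `β = -1`. -/
def alternant {R : Type*} [CommRing R] {N : ℕ} (y : Fin N → ℕ) (z : Fin N → R) :
    Matrix (Fin N) (Fin N) R :=
  Matrix.of fun j k => z j ^ y k * (1 - z j) ^ (k : ℕ)

/-- The matrix with rows `∑_{y < L} z ^ y, 1, 1 - z, (1 - z) ^ 2, …`. -/
def summedAlternant {R : Type*} [CommRing R] {N : ℕ} (L : ℕ) (z : Fin (N + 1) → R) :
    Matrix (Fin (N + 1)) (Fin (N + 1)) R :=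
  Matrix.of (Fin.cons (fun j => ∑ y ∈ Finset.range L, z j ^ y) fun k j => (1 - z j) ^ (k : ℕ))

theorem sum_det_alternant {R : Type*} [CommRing R] {N : ℕ} (L : ℕ) (z : Fin (N + 1) → R) :
    ∑ y ∈ strictAntiTuples (N + 1) L, (alternant y z).det = (summedAlternant L z).det := by
  have h := sum_strictAntiTuples_alternating N L
    (Matrix.detRowAlternating (R := R) (n := Fin (N + 1)))
    (fun k y j => z j ^ y * (1 - z j) ^ k) (fun k y => by
      ext j; simp only [Pi.sub_apply]; ring)
  convert h using 1
  · refine Finset.sum_congr rfl fun y _ => ?_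
    rw [← Matrix.det_transpose]
    rfl
  · unfold summedAlternant
    change Matrix.det _ = Matrix.det _
    congr 1
    ext k j
    induction k using Fin.cases <;> simp

/-- Apply the binomial theorem to `z = 1 - (1 - z)` in `(1 - z ^ L) / (1 - z)`; the point `z = 1` is
checked separately. -/
theorem sum_range_pow_eq (L : ℕ) (z : ℂ) :
    ∑ y ∈ Finset.range L, z ^ y =
      -∑ m ∈ Finset.Icc 1 L, (-1 : ℂ) ^ m * (L.choose m : ℂ) * (1 - z) ^ (m - 1) := by
  have hI : Finset.Icc 1 L = Finset.Ico 1 (L + 1) := rfl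
  rw [hI, Finset.sum_Ico_eq_sum_range]
  simp only [Nat.add_sub_cancel, Nat.add_sub_cancel_left]
  by_cases hz : 1 - z = 0
  · have : z = 1 := by linear_combination -hz
    subst this
    cases L with
    | zero => simp
    | succ L => simp [Finset.sum_range_succ', pow_succ]
  · apply mul_left_cancel₀ hz
    have h1 := mul_neg_geom_sum z L
    have h2 := add_pow (-(1 - z)) 1 L
    rw [Finset.sum_range_succ'] at h2
    rw [h1, mul_neg, Finset.mul_sum]
    have h3 : -(1 - z) + 1 = z := by ring
    rw [h3] at h2
    rw [h2]
    simp only [one_pow, mul_one, pow_zero, Nat.choose_zero_right, Nat.cast_one]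
    rw [sub_add_cancel_right, neg_inj]
    refine Finset.sum_congr rfl fun m _ => ?_
    rw [neg_pow, add_comm 1 m]; ring

/-- Both products are Vandermonde determinants, one with the columns reversed, so no inversions need
counting. This sign absorbs the reversal of the rows in `matrixV_eq`. -/
theorem sign_revPerm_mul_prod {R : Type*} [CommRing R] {N : ℕ} (z : Fin N → R) :
    ((Equiv.Perm.sign (Fin.revPerm : Equiv.Perm (Fin N)) : ℤ) : R) *
      ∏ j : Fin N, ∏ k ∈ Finset.Ioi j, (z k - z j) =
        ∏ j : Fin N, ∏ k ∈ Finset.Ioi j, (z j - z k) := by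
  rw [← Matrix.det_vandermonde, ← Matrix.det_permute']
  have h := Matrix.det_projVandermonde (1 : Fin N → R) z
  simp only [Pi.one_apply, one_mul] at h
  rw [← h]
  congr 1
  ext i j
  simp [Matrix.projVandermonde_apply]

/-- The unitriangular matrix that takes the reversed rows of `summedAlternant` to `matrixV`. -/
def rowOperations (L N : ℕ) : Matrix (Fin (N + 1)) (Fin (N + 1)) ℂ :=
  Matrix.of fun i j =>
    if j ≤ i ∧ ¬ (i = Fin.last N ∧ j = 0 ∧ 0 < N) then
      (-1 : ℂ) ^ ((i : ℕ) - j) * (L.choose (i - j) : ℂ) else 0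

theorem det_rowOperations (L N : ℕ) : (rowOperations L N).det = 1 := by
  rw [Matrix.det_of_isLowerTriangular]
  · refine Finset.prod_eq_one fun i _ => ?_
    have : ¬ (i = Fin.last N ∧ i = 0 ∧ 0 < N) := by
      rintro ⟨h1, h2, h3⟩
      rw [h1, Fin.ext_iff] at h2
      simp at h2; omega
    rw [rowOperations, Matrix.of_apply, if_pos ⟨le_rfl, this⟩]
    simp
  · intro i j hij
    have hij : i < j := hij
    simp [rowOperations, not_le.2 hij]

theorem matrixV_eq (L N : ℕ) (z : Fin (N + 1) → ℂ) :
    (matrixV L z : Matrix (Fin (N + 1)) (Fin (N + 1)) ℂ) =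
      rowOperations L N * (summedAlternant L z).submatrix Fin.revPerm id := by
  ext i k
  rw [Matrix.mul_apply, Fin.sum_univ_castSucc]
  have hB : ∀ j : Fin N, summedAlternant L z (Fin.revPerm j.castSucc) k =
      (1 - z k) ^ (N - 1 - (j : ℕ)) := by
    intro j
    have : Fin.revPerm j.castSucc = (Fin.rev j).succ := by
      rw [Fin.revPerm_apply, Fin.rev_castSucc]
    rw [this]
    simp [summedAlternant, Fin.val_rev, Nat.sub_sub, add_comm]
  have hl : summedAlternant L z (Fin.revPerm (Fin.last N)) k =
      ∑ y ∈ Finset.range L, z k ^ y := by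
    simp [summedAlternant]
  simp only [Matrix.submatrix_apply, id, hB, hl]
  induction i using Fin.lastCases with
  | cast i =>
    have h0 : rowOperations L N i.castSucc (Fin.last N) = 0 := by
      simp [rowOperations, not_le.2 (Fin.castSucc_lt_last i)]
    rw [h0, zero_mul, add_zero]
    have hi := i.isLt
    simp only [matrixV, Matrix.of_apply, Fin.val_castSucc, Nat.add_sub_cancel]
    rw [if_pos (by omega)]
    rw [← Finset.sum_range_reflect]
    have h1 : ∀ j : Fin N, rowOperations L N i.castSucc j.castSucc * (1 - z k) ^ (N - 1 - (j : ℕ)) =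
        (fun j : ℕ => if j ∈ Finset.range (i + 1) then (-1 : ℂ) ^ ((i : ℕ) - j) * (L.choose (i - j) : ℂ) *
          (1 - z k) ^ (N - 1 - j) else 0) j := by
      intro j
      have : i.castSucc ≠ Fin.last N := (Fin.castSucc_lt_last i).ne
      simp only [rowOperations, Matrix.of_apply, this, false_and, not_false_eq_true, and_true,
        Fin.val_castSucc, Finset.mem_range, Nat.lt_succ_iff,
        Fin.le_def]
      split_ifs <;> simp
    rw [Finset.sum_congr rfl fun j _ => h1 j]
    rw [Fin.sum_univ_eq_sum_range (fun j : ℕ => if j ∈ Finset.range (i + 1) then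
      (-1 : ℂ) ^ ((i : ℕ) - j) * (L.choose (i - j) : ℂ) * (1 - z k) ^ (N - 1 - j) else 0) N,
      Finset.sum_ite_mem,
      Finset.inter_eq_right.2 (by intro x; simp only [Finset.mem_range]; omega)]
    refine Finset.sum_congr rfl fun j hj => ?_
    rw [Finset.mem_range] at hj
    rw [show (i : ℕ) + 1 - 1 - j = i - j by omega, show (i : ℕ) - j + N - (i + 1) = N - 1 - j by omega]
  | last =>
    simp only [matrixV, Matrix.of_apply, Fin.val_last, Nat.add_sub_cancel]
    rw [if_neg (by omega)]
    have h0 : rowOperations L N (Fin.last N) (Fin.last N) = 1 := by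
      have : ¬ (Fin.last N = 0 ∧ 0 < N) := by
        rintro ⟨h2, h3⟩
        rw [Fin.ext_iff] at h2
        simp at h2; omega
      rw [rowOperations, Matrix.of_apply, if_pos ⟨le_rfl, fun h => this h.2⟩]
      simp
    rw [h0, one_mul, sum_range_pow_eq]
    set t : ℕ → ℂ := fun m => (-1 : ℂ) ^ m * (L.choose m : ℂ) * (1 - z k) ^ (m - 1) with ht
    -- Row `j` of the reversed matrix cancels the term `m = N - j` of the geometric sum. The omitted
    -- `j = 0` is why the term `m = N` stays in the last row of `matrixV`.
    have h1 : ∀ j : Fin N, rowOperations L N (Fin.last N) j.castSucc *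
        (1 - z k) ^ (N - 1 - (j : ℕ)) = (fun j : ℕ => if j = 0 then 0 else t (N - j)) j := by
      intro j
      have hj := j.isLt
      have h2 : (j.castSucc = 0) ↔ (j : ℕ) = 0 := by simp [Fin.ext_iff]
      simp only [rowOperations, Matrix.of_apply, h2, Fin.le_last, true_and]
      by_cases h : (j : ℕ) = 0
      · simp [h, show 0 < N by omega]
      · simp [h, ht, Nat.sub_right_comm]
    rw [Finset.sum_congr rfl fun j _ => h1 j,
      Fin.sum_univ_eq_sum_range (fun j : ℕ => if j = 0 then 0 else t (N - j)) N]
    have h2 : ∑ j ∈ Finset.range N, (if j = 0 then 0 else t (N - j)) =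
        ∑ m ∈ Finset.Ico 1 (max N 1), t m := by
      cases N with
      | zero => simp
      | succ N =>
        rw [Finset.sum_range_succ', Finset.sum_Ico_eq_sum_range, ← Finset.sum_range_reflect]
        simp only [if_true, add_zero, Nat.succ_ne_zero, if_false]
        rw [show max (N + 1) 1 - 1 = N by omega]
        refine Finset.sum_congr rfl fun j hj => ?_
        rw [Finset.mem_range] at hj
        congr 1
        omega
    -- Binomials vanish beyond `L`; the common larger bound lets the two ranges be joined even when
    -- `L < N`.
    have h3 : ∀ a, ∑ m ∈ Finset.Icc a L, t m = ∑ m ∈ Finset.Ico a (max N 1 + L + 1), t m := by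
      intro a
      refine Finset.sum_subset (fun m => by simp only [Finset.mem_Icc, Finset.mem_Ico]; omega) ?_
      intro m hm hm'
      have : L < m := by
        simp only [Finset.mem_Icc, Finset.mem_Ico] at hm hm'
        omega
      simp [ht, Nat.choose_eq_zero_of_lt this]
    change -∑ m ∈ Finset.Icc (max N 1) L, t m = _ + -∑ m ∈ Finset.Icc 1 L, t m
    rw [h2, h3, h3]
    linear_combination -Finset.sum_Ico_consecutive t (le_max_right N 1)
      (show max N 1 ≤ max N 1 + L + 1 by omega)

theorem det_matrixV (L N : ℕ) (z : Fin (N + 1) → ℂ) :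
    (∏ j : Fin (N + 1), ∏ k ∈ Finset.Ioi j, 1 / (z k - z j)) * (matrixV L z).det =
      (summedAlternant L z).det / ∏ j : Fin (N + 1), ∏ k ∈ Finset.Ioi j, (z j - z k) := by
  rw [matrixV_eq, Matrix.det_mul, det_rowOperations, one_mul, Matrix.det_permute,
    ← sign_revPerm_mul_prod]
  simp only [one_div, Finset.prod_inv_distrib]
  rcases Int.units_eq_one_or (Equiv.Perm.sign (Fin.revPerm : Equiv.Perm (Fin (N + 1)))) with h | h <;>
    rw [h] <;> simp [div_eq_mul_inv] <;> ring

/-! ### Diagonal form of the vacancy string and exponents of diagrams -/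

theorem siteOperator_vacancy {M : ℕ} [NeZero M] (i : ZMod M) :
    siteOperator vacancy i = Matrix.diagonal fun σ : Config M => if σ i = 0 then 1 else 0 := by
  ext σ τ
  rw [Matrix.diagonal_apply, siteOperator]
  by_cases h : σ = τ
  · subst h
    have : vacancy (σ i) (σ i) = if σ i = 0 then 1 else 0 := by
      generalize σ i = a
      fin_cases a <;> simp [vacancy]
    simp [this]
  · rw [if_neg h]
    by_cases hi : σ i = τ i
    · obtain ⟨k, hk⟩ := Function.ne_iff.1 h
      have hki : k ≠ i := by rintro rfl; exact hk hi
      rw [Finset.prod_eq_zero (Finset.mem_erase.2 ⟨hki, Finset.mem_univ k⟩) (if_neg hk), mul_zero]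
    · have : vacancy (σ i) (τ i) = 0 := by
        generalize σ i = a at hi ⊢
        generalize τ i = b at hi ⊢
        fin_cases a <;> fin_cases b <;> simp [vacancy] at hi ⊢
      rw [this, zero_mul]

theorem vacancyString_eq_diagonal (M : ℕ) [NeZero M] (l : ℤ) (n : ℕ) :
    vacancyString M l n = Matrix.diagonal fun σ : Config M =>
      if ∀ i < n, σ ((l + (i : ℤ) : ℤ) : ZMod M) = 0 then 1 else 0 := by
  induction n with
  | zero => simp [vacancyString]
  | succ n ih =>
    have : vacancyString M l (n + 1) = vacancyString M l n *
        siteOperator vacancy ((l + (n : ℤ) : ℤ) : ZMod M) := by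
      simp [vacancyString, List.range_succ]
    rw [this, ih, siteOperator_vacancy, Matrix.diagonal_mul_diagonal]
    congr 1
    ext σ
    simp only [Nat.forall_lt_succ_right, ← ite_and, mul_ite, mul_one, mul_zero]
    congr 1
    exact propext and_comm

/-- The exponents `lam k + N - 1 - k` (`k ≥ 0`), which are the positions of the particles, in
decreasing order, minus one. -/
def exponents {N K : ℕ} (lam : Fin N → Fin K) (k : Fin N) : ℕ :=
  (lam k : ℕ) + (N - 1 - (k : ℕ))

/-- No particle of the configuration with occupied sites `y k + 1` is at one of the sites
`l, …, l + n - 1` modulo `M`. -/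
def Vacant (M : ℕ) {N : ℕ} (l : ℤ) (n : ℕ) (y : Fin N → ℕ) : Prop :=
  ∀ i < n, ∀ k, ((y k : ZMod M) + 1) ≠ (l : ZMod M) + i

theorem position_eq {N K : ℕ} (lam : Fin N → Fin K) (j : Fin N) :
    position lam j = exponents lam j.rev + 1 := by
  have := j.isLt
  simp only [position, exponents, Fin.val_rev]
  omega

theorem diagramConfig_apply_eq_zero {M N K : ℕ} (lam : Fin N → Fin K) (i : ZMod M) :
    diagramConfig M lam i = 0 ↔ ∀ k, (exponents lam k : ZMod M) + 1 ≠ i := by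
  unfold diagramConfig
  rw [ite_eq_right_iff]
  simp only [one_ne_zero, imp_false, not_exists, position_eq, Nat.cast_add, Nat.cast_one]
  exact ⟨fun h k => by simpa using h k.rev, fun h k => h k.rev⟩

theorem exponents_mem {M N : ℕ} (hNM : N ≤ M) {lam : Fin N → Fin (M - N + 1)}
    (h : lam ∈ boxDiagrams M N) : exponents lam ∈ strictAntiTuples N M := by
  have h : Antitone lam := by simpa [boxDiagrams] using h
  rw [mem_strictAntiTuples]
  constructor
  · intro k
    have := (lam k).isLt
    have := k.isLt
    simp only [exponents]
    omega
  · intro a b hab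
    have h1 : (lam b : ℕ) ≤ lam a := h hab.le
    have h2 : (a : ℕ) < b := hab
    have := b.isLt
    simp only [exponents]
    omega

theorem exponents_injective {N K : ℕ} :
    Function.Injective (exponents : (Fin N → Fin K) → Fin N → ℕ) := by
  intro lam lam' h
  ext k
  have := congrFun h k
  simpa [exponents] using this

/-- Integer entries drop by at least one per step. This yields the bounds that place the diagram
recovered from `y` inside the box. -/
theorem antitone_add_of_strictAnti {N : ℕ} {y : Fin N → ℕ} (hy : StrictAnti y) :
    Antitone fun k => y k + (k : ℕ) := by
  intro a b hab
  have key : ∀ d : ℕ, ∀ c : Fin N, (c : ℕ) = a + d → y c + d ≤ y a := by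
    intro d
    induction d with
    | zero => intro c hc; rw [Fin.ext (a := c) (b := a) (by omega)]; simp
    | succ d ih =>
      intro c hc
      have h1 := ih ⟨a + d, by omega⟩ rfl
      have h2 : y c < y ⟨a + d, by omega⟩ := hy (by rw [Fin.lt_def, hc]; simp)
      omega
  have h0 : (a : ℕ) ≤ b := hab
  have := key (b - a) b (by omega)
  change y b + (b : ℕ) ≤ y a + (a : ℕ)
  omega

theorem sum_boxDiagrams {A : Type*} [AddCommMonoid A] {M N : ℕ} (hN : 1 ≤ N) (hNM : N ≤ M)
    (f : (Fin N → ℕ) → A) :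
    ∑ lam ∈ boxDiagrams M N, f (exponents lam) = ∑ y ∈ strictAntiTuples N M, f y := by
  refine Finset.sum_nbij exponents (fun _ => exponents_mem hNM)
    exponents_injective.injOn ?_ fun _ _ => rfl
  intro y hy
  rw [Finset.mem_coe, mem_strictAntiTuples] at hy
  obtain ⟨hM, hy⟩ := hy
  have hanti := antitone_add_of_strictAnti hy
  have hle : ∀ k : Fin N, N - 1 - (k : ℕ) ≤ y k := fun k => by
    have h1 := hanti (show k ≤ ⟨N - 1, by omega⟩ by rw [Fin.le_def]; simp; omega)
    simp only at h1
    omega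
  have hge : ∀ k : Fin N, y k + k ≤ M - 1 := fun k => by
    have h1 := hanti (show ⟨0, by omega⟩ ≤ k by rw [Fin.le_def]; simp)
    have := hM ⟨0, by omega⟩
    simp only at h1
    omega
  refine ⟨fun k => ⟨y k - (N - 1 - k), ?_⟩, ?_, ?_⟩
  · have := hge k
    have := k.isLt
    omega
  · rw [Finset.mem_coe, boxDiagrams, Finset.mem_filter]
    refine ⟨Finset.mem_univ _, fun a b hab => ?_⟩
    rw [Fin.le_def]
    have h1 := hanti hab
    have h2 : (a : ℕ) ≤ b := hab
    have := hle a
    have := hle b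
    have := b.isLt
    simp only at h1 ⊢
    omega
  · ext k
    have := hle k
    simp only [exponents]
    omega

/-- Positions lie in `1, …, M`, hence are determined by their residues. So distinct diagrams give
distinct basis vectors, and off-diagonal matrix elements vanish. -/
theorem diagramConfig_injOn {M N : ℕ} [NeZero M] (hNM : N ≤ M) :
    Set.InjOn (diagramConfig M : (Fin N → Fin (M - N + 1)) → Config M) (boxDiagrams M N) := by
  intro lam h lam' h' heq
  obtain ⟨hl, hs⟩ := mem_strictAntiTuples.1 (exponents_mem hNM h)
  obtain ⟨hl', hs'⟩ := mem_strictAntiTuples.1 (exponents_mem hNM h')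
  have key : ∀ i : ZMod M, (∃ k, (exponents lam k : ZMod M) + 1 = i) ↔
      ∃ k, (exponents lam' k : ZMod M) + 1 = i := by
    intro i
    rw [← not_iff_not]
    push Not
    rw [← diagramConfig_apply_eq_zero, ← diagramConfig_apply_eq_zero, heq]
  have sub : ∀ {y y' : Fin N → ℕ}, (∀ k, y k < M) → (∀ k, y' k < M) →
      (∀ i : ZMod M, (∃ k, (y k : ZMod M) + 1 = i) → ∃ k, (y' k : ZMod M) + 1 = i) →
      Set.range y ⊆ Set.range y' := by
    rintro y y' hy hy' h _ ⟨k, rfl⟩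
    obtain ⟨k', hk'⟩ := h _ ⟨k, rfl⟩
    refine ⟨k', ?_⟩
    have := (ZMod.natCast_eq_natCast_iff' _ _ _).1 (add_right_cancel hk')
    rwa [Nat.mod_eq_of_lt (hy k), Nat.mod_eq_of_lt (hy' k')] at this
  exact exponents_injective ((hs.range_inj hs').1
    ((sub hl hl' fun i => (key i).1).antisymm (sub hl' hl fun i => (key i).2)))

open Classical in
/-- The particle configurations, written as decreasing tuples, in which the sites
`l, …, l + n - 1` modulo `M` are empty. -/
noncomputable def vacantTuples (M N : ℕ) (l : ℤ) (n : ℕ) : Finset (Fin N → ℕ) :=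
  {y ∈ strictAntiTuples N M | Vacant M l n y}

theorem mem_vacantTuples {M N : ℕ} {l : ℤ} {n : ℕ} {y : Fin N → ℕ} :
    y ∈ vacantTuples M N l n ↔ y ∈ strictAntiTuples N M ∧ Vacant M l n y := by
  simp [vacantTuples]

/-- The ratio `det (z_j ^ y_k * (1 - z_j) ^ k) / ∏_{j < k} (z_j - z_k)`. -/
noncomputable def alternantRatio {N : ℕ} (y : Fin N → ℕ) (z : Fin N → ℂ) : ℂ :=
  (alternant y z).det / ∏ j : Fin N, ∏ k ∈ Finset.Ioi j, (z j - z k)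

theorem grothendieck_eq {N K : ℕ} (lam : Fin N → Fin K) (z : Fin N → ℂ) :
    grothendieck (-1) lam z = alternantRatio (exponents lam) z := by
  unfold grothendieck alternantRatio alternant exponents
  simp only [neg_mul, one_mul, ← sub_eq_add_neg]

theorem formFactorSum_eq {M N : ℕ} [NeZero M] (hN : 1 ≤ N) (hNM : N ≤ M) (l : ℤ) (n : ℕ)
    (z : Fin N → ℂ) :
    formFactorSum (vacancyString M l n) z = ∑ y ∈ vacantTuples M N l n, alternantRatio y z := by
  classical
  rw [vacantTuples, Finset.sum_filter, ← sum_boxDiagrams hN hNM]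
  unfold formFactorSum
  refine Finset.sum_congr rfl fun nu hnu => ?_
  rw [Finset.sum_eq_single nu]
  · rw [matrixElement, vacancyString_eq_diagonal, Matrix.diagonal_apply_eq, grothendieck_eq,
      ite_mul, one_mul, zero_mul]
    congr 1
    simp only [Vacant, diagramConfig_apply_eq_zero, Int.cast_add, Int.cast_natCast]
  · intro mu hmu hne
    rw [matrixElement, vacancyString_eq_diagonal, Matrix.diagonal_apply_ne, zero_mul]
    exact fun h => hne (diagramConfig_injOn hNM hnu hmu h).symm
  · exact fun h => absurd hnu h

/-! ### The case `l ≤ 1`: allowed exponents form an interval -/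

/-- The forbidden exponents are the residues of `[a - n, a)`. Since `a - n ≤ 0 ≤ a`, within `[0, M)`
they are the initial piece `[0, a)` and, after wrapping, the final piece `[a - n + M, M)`. -/
theorem vacant_iff_of_le_one {M N : ℕ} {l : ℤ} {n a : ℕ} (hl : l ≤ 1) (ha : (a : ℤ) = l + n - 1)
    (hn : n ≤ M) {y : Fin N → ℕ} (hy : ∀ k, y k < M) :
    Vacant M l n y ↔ ∀ k, a ≤ y k ∧ y k < a + (M - n) := by
  have cast : ∀ (i : ℕ) (k : Fin N), (y k : ZMod M) + 1 = (l : ZMod M) + i ↔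
      (M : ℤ) ∣ l + i - (y k + 1) := by
    intro i k
    rw [← ZMod.intCast_eq_intCast_iff_dvd_sub]
    push_cast
    rfl
  constructor
  · intro h k
    have hk := hy k
    by_contra hc
    rw [not_and_or, not_le, not_lt] at hc
    rcases hc with hc | hc
    · refine h (y k + 1 - l).toNat (by omega) k ((cast _ _).2 ?_)
      rw [Int.toNat_of_nonneg (by omega)]
      simp
    · refine h (y k + 1 - M - l).toNat (by omega) k ((cast _ _).2 ?_)
      rw [Int.toNat_of_nonneg (by omega)]
      exact ⟨-1, by ring⟩
  · intro h i hi k hc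
    obtain ⟨c, hc⟩ := (cast i k).1 hc
    have hk := h k
    have hM := hy k
    -- The multiple `M * c` lies strictly between `-M` and `0`, which is impossible.
    have h1 : c < 0 := by
      by_contra h0
      have := mul_nonneg (Int.natCast_nonneg M) (not_lt.1 h0)
      omega
    have h2 : -1 < c := by
      by_contra h0
      have := mul_nonneg (Int.natCast_nonneg M) (show 0 ≤ -1 - c by omega)
      rw [mul_sub] at this
      omega
    omega

theorem sum_vacantTuples_of_le_one {A : Type*} [AddCommMonoid A] {M N : ℕ} {l : ℤ} {n a : ℕ}
    (hl : l ≤ 1) (ha : (a : ℤ) = l + n - 1) (hn : n ≤ M) (f : (Fin N → ℕ) → A) :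
    ∑ y ∈ vacantTuples M N l n, f y = ∑ y ∈ strictAntiTuples N (M - n), f fun k => y k + a := by
  symm
  refine Finset.sum_nbij' (fun y k => y k + a) (fun y k => y k - a) ?_ ?_ ?_ ?_ fun _ _ => rfl
  · intro y hy
    obtain ⟨h1, h2⟩ := mem_strictAntiTuples.1 hy
    have h3 : ∀ k, y k + a < M := fun k => by have := h1 k; omega
    rw [mem_vacantTuples, mem_strictAntiTuples, vacant_iff_of_le_one hl ha hn h3]
    refine ⟨⟨h3, fun i j hij => ?_⟩, fun k => ?_⟩
    · have := h2 hij
      simp only; omega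
    · have := h1 k
      omega
  · intro y hy
    rw [mem_vacantTuples, mem_strictAntiTuples] at hy
    obtain ⟨⟨h1, h2⟩, h3⟩ := hy
    rw [vacant_iff_of_le_one hl ha hn h1] at h3
    rw [mem_strictAntiTuples]
    refine ⟨fun k => ?_, fun i j hij => ?_⟩
    · have := h3 k
      omega
    · have := h2 hij
      have := h3 j
      simp only; omega
  · intro y _
    simp
  · intro y hy
    rw [mem_vacantTuples, mem_strictAntiTuples] at hy
    obtain ⟨⟨h1, h2⟩, h3⟩ := hy
    rw [vacant_iff_of_le_one hl ha hn h1] at h3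
    ext k
    have := h3 k
    simp only; omega

theorem det_alternant_add {R : Type*} [CommRing R] {N : ℕ} (a : ℕ) (y : Fin N → ℕ) (z : Fin N → R) :
    (alternant (fun k => y k + a) z).det = (∏ j, z j) ^ a * (alternant y z).det := by
  rw [← Finset.prod_pow, ← Matrix.det_mul_column]
  congr 1
  ext j k
  simp only [alternant, Matrix.of_apply]
  ring

theorem alternantRatio_add {N : ℕ} (a : ℕ) (y : Fin N → ℕ) (z : Fin N → ℂ) :
    alternantRatio (fun k => y k + a) z = (∏ j, z j) ^ a * alternantRatio y z := by
  rw [alternantRatio, det_alternant_add, mul_div_assoc, alternantRatio]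

theorem sum_alternantRatio {M N : ℕ} {l : ℤ} {n : ℕ} (hl : l ≤ 1) (hln : 1 - l ≤ n) (hn : n ≤ M)
    (z : Fin (N + 1) → ℂ) :
    ∑ y ∈ vacantTuples M (N + 1) l n, alternantRatio y z = determinantSide M l n z := by
  obtain ⟨a, ha⟩ := Int.eq_ofNat_of_zero_le (show 0 ≤ l + n - 1 by omega)
  rw [sum_vacantTuples_of_le_one hl ha.symm hn]
  simp only [alternantRatio_add]
  rw [← Finset.mul_sum, determinantSide, mul_assoc, det_matrixV, ha]
  simp only [zpow_natCast, Finset.prod_pow, alternantRatio]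
  rw [← Finset.sum_div, sum_det_alternant]

/-! ### Rotation of the lattice and the Bethe equations -/

/-- The cyclic shift of all particles by one site. -/
def rotate (M : ℕ) {N : ℕ} (y : Fin (N + 1) → ℕ) : Fin (N + 1) → ℕ :=
  if y 0 + 1 < M then fun k => y k + 1 else Fin.snoc (fun k : Fin N => y k.succ + 1) 0

theorem strictAnti_snoc {N : ℕ} {y : Fin N → ℕ} (hy : StrictAnti y) (h0 : ∀ k, 0 < y k) :
    StrictAnti (Fin.snoc y 0 : Fin (N + 1) → ℕ) := by
  intro a b hab
  induction a using Fin.lastCases with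
  | last => exact absurd hab (not_lt.2 (Fin.le_last b))
  | cast a =>
    induction b using Fin.lastCases with
    | last => simpa using h0 a
    | cast b => simpa using hy (Fin.castSucc_lt_castSucc_iff.1 hab)

theorem rotate_mem {M N : ℕ} {y : Fin (N + 1) → ℕ} (hy : y ∈ strictAntiTuples (N + 1) M) :
    rotate M y ∈ strictAntiTuples (N + 1) M := by
  obtain ⟨h1, h2⟩ := mem_strictAntiTuples.1 hy
  rw [mem_strictAntiTuples, rotate]
  split_ifs with h
  · refine ⟨fun k => ?_, fun i j hij => Nat.succ_lt_succ (h2 hij)⟩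
    have := h2.antitone (Fin.zero_le k)
    simp only
    omega
  · refine ⟨fun k => ?_, strictAnti_snoc (fun i j hij => ?_) fun k => by simp⟩
    · induction k using Fin.lastCases with
      | last => have := h1 0; simp; omega
      | cast k =>
        have := h2 (Fin.succ_pos k)
        have := h1 0
        simp only [Fin.snoc_castSucc]
        omega
    · exact Nat.succ_lt_succ (h2 (Fin.succ_lt_succ_iff.2 hij))

theorem rotate_injOn (M N : ℕ) :
    Set.InjOn (rotate M : (Fin (N + 1) → ℕ) → _) (strictAntiTuples (N + 1) M) := by
  intro y hy y' hy' heq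
  have hM := (mem_strictAntiTuples.1 hy).1 0
  have hM' := (mem_strictAntiTuples.1 hy').1 0
  unfold rotate at heq
  split_ifs at heq with h h' h'
  · ext k
    simpa using congrFun heq k
  · simpa using congrFun heq (Fin.last N)
  · simpa using congrFun heq (Fin.last N)
  · ext k
    induction k using Fin.cases with
    | zero => omega
    | succ k => simpa using congrFun heq k.castSucc

theorem vacant_rotate {M N : ℕ} {l : ℤ} {n : ℕ} {y : Fin (N + 1) → ℕ}
    (hy : y ∈ strictAntiTuples (N + 1) M) :
    Vacant M (l + 1) n (rotate M y) ↔ Vacant M l n y := by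
  unfold Vacant
  refine forall₂_congr fun i _ => ?_
  have hM := (mem_strictAntiTuples.1 hy).1 0
  have e : ∀ x : ZMod M, (x + 1 + 1 = ((l + 1 : ℤ) : ZMod M) + i) ↔ x + 1 = (l : ZMod M) + i := by
    intro x
    push_cast
    rw [add_right_comm (l : ZMod M), add_left_inj]
  unfold rotate
  split_ifs with h
  · simp only [Nat.cast_add, Nat.cast_one, ne_eq, e]
  · rw [Fin.forall_fin_succ', Fin.forall_fin_succ (P := fun k => (y k : ZMod M) + 1 ≠ _)]
    simp only [Fin.snoc_castSucc, Fin.snoc_last, Nat.cast_add, Nat.cast_one, ne_eq, e]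
    -- The wrapped particle receives exponent `0` in place of `M`, which is the same residue.
    have h0 : (y 0 : ZMod M) + 1 = 0 := by
      have : y 0 + 1 = M := by omega
      exact_mod_cast (congrArg (Nat.cast : ℕ → ZMod M) this).trans (ZMod.natCast_self M)
    rw [← e (y 0), h0, and_comm]
    simp

theorem sum_vacantTuples_rotate {A : Type*} [AddCommMonoid A] (M N : ℕ) (l : ℤ) (n : ℕ)
    (f : (Fin (N + 1) → ℕ) → A) :
    ∑ y ∈ vacantTuples M (N + 1) l n, f (rotate M y) =
      ∑ y ∈ vacantTuples M (N + 1) (l + 1) n, f y := by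
  refine Finset.sum_nbij (rotate M) ?_ ?_ ?_ fun _ _ => rfl
  · intro y hy
    rw [mem_vacantTuples] at hy ⊢
    exact ⟨rotate_mem hy.1, (vacant_rotate hy.1).2 hy.2⟩
  · exact (rotate_injOn M N).mono fun y hy => (mem_vacantTuples.1 hy).1
  · intro y hy
    rw [Finset.mem_coe, mem_vacantTuples] at hy
    -- An injective self-map of a finite set is surjective.
    obtain ⟨x, hx, rfl⟩ := Finset.surjOn_of_injOn_of_card_le (rotate M)
      (fun x hx => rotate_mem hx) (rotate_injOn M N) le_rfl hy.1
    exact ⟨x, mem_vacantTuples.2 ⟨hx, (vacant_rotate hx).1 hy.2⟩, rfl⟩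

/-- Multiplying row `j` by `1 - z j` raises every weight by one, as needed once the last column is
moved to the front by an `(N + 1)`-cycle of sign `(-1) ^ N`. -/
theorem det_alternant_snoc {R : Type*} [CommRing R] {N : ℕ} (y : Fin N → ℕ)
    (z : Fin (N + 1) → R) :
    (∏ j, (1 - z j)) * (alternant (Fin.snoc y 0 : Fin (N + 1) → ℕ) z).det =
      (-1) ^ N * (Matrix.of fun j => (Fin.cons ((1 - z j) ^ (N + 1))
        fun k : Fin N => z j ^ y k * (1 - z j) ^ (k + 1 : ℕ) : Fin (N + 1) → R)).det := by
  have hs : ((Equiv.Perm.sign (finRotate (N + 1)) : ℤ) : R) = (-1) ^ N := by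
    rw [sign_finRotate]; simp
  rw [← hs, ← Matrix.det_permute', ← Matrix.det_mul_column]
  congr 1
  ext j k
  induction k using Fin.lastCases with
  | last => simp [alternant, pow_succ']
  | cast k =>
    have : finRotate (N + 1) k.castSucc = k.succ := by
      simp
    simp [alternant]
    ring

/-- Without wrapping, this is a translation of exponents. With wrapping, the column `(1 - z j) ^ (N
+ 1)` from `det_alternant_snoc` is, by the Bethe equations, a constant times `z j ^ M`, the missing
first column of the translated alternant. -/
theorem BetheEquations.alternantRatio_rotate {M N : ℕ} {z : Fin (N + 1) → ℂ}
    (hz : BetheEquations M z) (hinj : Function.Injective z) {y : Fin (N + 1) → ℕ}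
    (hy : y ∈ strictAntiTuples (N + 1) M) :
    alternantRatio (rotate M y) z = (∏ j, z j) * alternantRatio y z := by
  have hM := (mem_strictAntiTuples.1 hy).1 0
  unfold rotate
  split_ifs with h
  · rw [alternantRatio_add, pow_one]
  have hyM : y 0 + 1 = M := by omega
  unfold alternantRatio
  rw [mul_div_assoc', ← pow_one (∏ j, z j), ← det_alternant_add]
  congr 1
  -- If the factor to be cancelled vanishes, the Bethe equations force every `z j = 1`; distinctness
  -- then leaves a single particle.
  by_cases h0 : ∏ j, (1 - z j) = 0
  · have hone : ∀ j, z j = 1 := fun j => by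
      have h1 := (hz j).2
      rw [h0, mul_zero, mul_eq_zero] at h1
      rcases h1 with h1 | h1
      · exact absurd h1 (inv_ne_zero (pow_ne_zero _ (hz j).1))
      · exact (sub_eq_zero.1 (pow_eq_zero_iff (Nat.succ_ne_zero N) |>.1 h1)).symm
    cases N with
    | succ N => exact absurd (hinj ((hone 0).trans (hone 1).symm)) (by simp)
    | zero => simp [alternant, hone]
  · apply mul_left_cancel₀ h0
    rw [det_alternant_snoc]
    have hcol : ∀ j, (1 - z j) ^ (N + 1) = z j ^ M * ((-1) ^ N * ∏ j, (1 - z j)) := fun j => by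
      obtain ⟨h1, h2⟩ := hz j
      rw [inv_mul_eq_iff_eq_mul₀ (pow_ne_zero _ h1)] at h2
      simpa using h2
    have hmat : (Matrix.of fun j => (Fin.cons ((1 - z j) ^ (N + 1))
        fun k : Fin N => z j ^ (y k.succ + 1) * (1 - z j) ^ (k + 1 : ℕ) : Fin (N + 1) → ℂ)) =
        (alternant (fun k => y k + 1) z).updateCol 0
          (((-1) ^ N * ∏ j, (1 - z j)) • fun j => z j ^ M) := by
      ext j k
      induction k using Fin.cases with
      | zero => simp [hcol]; ring
      | succ k => simp [alternant]
    rw [hmat, Matrix.det_updateCol_smul]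
    -- Since `y 0 + 1 = M` and column `0` has weight `(1 - z j) ^ 0`, the replaced column is the
    -- original one.
    have hself : (alternant (fun k => y k + 1) z).updateCol 0 (fun j => z j ^ M) =
        alternant (fun k => y k + 1) z := by
      ext j k
      induction k using Fin.cases with
      | zero => simp [alternant, hyM]
      | succ k => simp
    rw [hself, ← mul_assoc, ← mul_assoc, ← mul_pow]
    simp

theorem BetheEquations.sum_alternantRatio_add_one {M N : ℕ} {z : Fin (N + 1) → ℂ}
    (hz : BetheEquations M z) (hinj : Function.Injective z) (l : ℤ) (n : ℕ) :
    ∑ y ∈ vacantTuples M (N + 1) (l + 1) n, alternantRatio y z =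
      (∏ j, z j) * ∑ y ∈ vacantTuples M (N + 1) l n, alternantRatio y z := by
  rw [← sum_vacantTuples_rotate, Finset.mul_sum]
  exact Finset.sum_congr rfl fun y hy =>
    hz.alternantRatio_rotate hinj (mem_vacantTuples.1 hy).1

theorem determinantSide_add {M N : ℕ} (l : ℤ) (d n : ℕ) (z : Fin N → ℂ) (hz : ∀ j, z j ≠ 0) :
    determinantSide M (l + d) n z = (∏ j, z j) ^ d * determinantSide M l n z := by
  have h : ∀ j, z j ^ (l + d + n - 1) = z j ^ d * z j ^ (l + n - 1) := fun j => by
    rw [← zpow_natCast, ← zpow_add₀ (hz j)]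
    congr 1; ring
  simp only [determinantSide, h, Finset.prod_mul_distrib, Finset.prod_pow, mul_assoc]

theorem BetheEquations.sum_alternantRatio {M N : ℕ} {z : Fin (N + 1) → ℂ}
    (hz : BetheEquations M z) (hinj : Function.Injective z) (d : ℕ) {n : ℕ} (hn : n ≤ M) :
    ∑ y ∈ vacantTuples M (N + 1) (1 + d) n, alternantRatio y z =
      determinantSide M (1 + d) n z := by
  rw [determinantSide_add _ _ _ _ fun j => (hz j).1,
    ← VacancyTASEP.sum_alternantRatio le_rfl (by simp) hn]
  induction d with
  | zero => simp
  | succ d ih =>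
    rw [Nat.cast_succ, ← add_assoc, hz.sum_alternantRatio_add_one hinj, ih]
    ring

/-! ### Newton interpolation and limits at coinciding coordinates -/

open Polynomial in
/-- The iterated quotients in the Newton interpolation of `f` at the nodes `x 0, x 1, …`. -/
noncomputable def newtonQuotient {R : Type*} [CommRing R] (x : ℕ → R) (f : R[X]) : ℕ → R[X]
  | 0 => f
  | i + 1 => -(newtonQuotient x f i /ₘ (X - C (x i)))

-- Division by a monic polynomial commutes with ring homomorphisms, so the nodes can be specialised
-- to coinciding values.
open Polynomial in
theorem newtonQuotient_map {R S : Type*} [CommRing R] [CommRing S] (φ : R →+* S) (x : ℕ → R)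
    (f : R[X]) (i : ℕ) :
    (newtonQuotient x f i).map φ = newtonQuotient (fun m => φ (x m)) (f.map φ) i := by
  induction i with
  | zero => rfl
  | succ i ih =>
    simp [newtonQuotient, Polynomial.map_divByMonic φ (monic_X_sub_C (x i)), ih]

open Polynomial in
theorem newtonQuotient_succ {R : Type*} [CommRing R] (x : ℕ → R) (f : R[X]) (i : ℕ) :
    newtonQuotient x f i =
      C ((newtonQuotient x f i).eval (x i)) + (C (x i) - X) * newtonQuotient x f (i + 1) := by
  have h := modByMonic_add_div (newtonQuotient x f i) (X - C (x i))
  rw [modByMonic_X_sub_C_eq_C_eval] at h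
  nth_rewrite 1 [← h]
  rw [newtonQuotient]
  ring

open Polynomial in
theorem newton_expansion {R : Type*} [CommRing R] (x : ℕ → R) (f : R[X]) (n : ℕ) :
    f = ∑ i ∈ Finset.range n,
        C ((newtonQuotient x f i).eval (x i)) * ∏ m ∈ Finset.range i, (C (x m) - X) +
      (∏ m ∈ Finset.range n, (C (x m) - X)) * newtonQuotient x f n := by
  induction n with
  | zero => simp [newtonQuotient]
  | succ n ih =>
    rw [Finset.sum_range_succ, Finset.prod_range_succ]
    rw [newtonQuotient_succ x f n] at ih
    linear_combination ih

-- The Newton expansion at the nodes factors the matrix of values into a triangular matrix, whose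
-- diagonal gives the Vandermonde product, and the matrix of Newton coefficients. No division by
-- differences of nodes occurs.
open Polynomial in
theorem det_eval_eq_prod_mul {R : Type*} [CommRing R] {N : ℕ} (x : ℕ → R) (f : Fin N → R[X]) :
    (Matrix.of fun j k : Fin N => (f k).eval (x j)).det =
      (∏ j : Fin N, ∏ k ∈ Finset.Ioi j, (x j - x k)) *
        (Matrix.of fun i k : Fin N => (newtonQuotient x (f k) i).eval (x i)).det := by
  have hL : (Matrix.of fun j i : Fin N => ∏ m ∈ Finset.Iio i, (x m - x j)).det =
      ∏ j : Fin N, ∏ k ∈ Finset.Ioi j, (x j - x k) := by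
    rw [Matrix.det_of_isLowerTriangular]
    · simp only [Matrix.of_apply]
      exact Finset.prod_comm' (by simp)
    · intro j i hij
      have hij : j < i := hij
      rw [Matrix.of_apply]
      exact Finset.prod_eq_zero (Finset.mem_Iio.2 hij) (sub_self _)
  rw [← hL, ← Matrix.det_mul]
  congr 1
  ext j k
  rw [Matrix.mul_apply, Matrix.of_apply]
  nth_rewrite 1 [newton_expansion x (f k) N]
  -- The remainder of the expansion vanishes at each of the first `N` nodes.
  have h0 : ∏ m ∈ Finset.range N, (x m - x j) = 0 :=
    Finset.prod_eq_zero (Finset.mem_range.2 j.isLt) (sub_self _)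
  simp only [eval_add, eval_mul, eval_finsetSum, eval_C, eval_prod, eval_sub, eval_X, h0, zero_mul,
    add_zero, Matrix.of_apply]
  rw [← Fin.sum_univ_eq_sum_range
    (fun i => (newtonQuotient x (f k) i).eval (x i) * ∏ m ∈ Finset.range i, (x m - x j))]
  refine Finset.sum_congr rfl fun i _ => ?_
  rw [mul_comm]
  congr 1
  refine (Finset.prod_nbij (fun m : Fin N => (m : ℕ)) ?_ Fin.val_injective.injOn ?_
    fun _ _ => rfl).symm
  · intro m hm
    simpa using hm
  · intro m hm
    have hm : m < i := by simpa using hm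
    exact ⟨⟨m, hm.trans i.isLt⟩, by simpa [Fin.lt_def] using hm, rfl⟩

open Polynomial in
theorem newtonQuotient_one {R : Type*} [CommRing R] [Nontrivial R] (p k i : ℕ) (hik : i ≤ k) :
    newtonQuotient (fun _ => (1 : R)) (X ^ p * (1 - X) ^ k) i = X ^ p * (1 - X) ^ (k - i) := by
  induction i with
  | zero => rfl
  | succ i ih =>
    rw [newtonQuotient, ih (by omega), show k - i = k - (i + 1) + 1 by omega,
      show X ^ p * (1 - X : R[X]) ^ (k - (i + 1) + 1) =
        (X - C 1) * (-(X ^ p * (1 - X) ^ (k - (i + 1)))) by rw [C_1]; ring,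
      mul_divByMonic_cancel_left _ (monic_X_sub_C 1), neg_neg]

-- Taking the variables themselves as nodes, the determinant of Newton coefficients is the required
-- polynomial. When all nodes become `1`, each quotient strips one factor `1 - X` from `X ^ y k * (1
-- - X) ^ k`, so the coefficient matrix is unitriangular.
open Polynomial in
theorem exists_alternantRatio_eq_eval {N : ℕ} (y : Fin N → ℕ) :
    ∃ P : MvPolynomial (Fin N) ℂ,
      (∀ w : Fin N → ℂ, Function.Injective w → alternantRatio y w = MvPolynomial.eval w P) ∧
        MvPolynomial.eval (fun _ => 1) P = 1 := by
  -- Padding by `1` makes the whole node sequence constant when the variables are set to `1`.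
  let x : ℕ → MvPolynomial (Fin N) ℂ := fun m => if h : m < N then MvPolynomial.X ⟨m, h⟩ else 1
  have hx : ∀ j : Fin N, x j = MvPolynomial.X j := fun j => by simp [x]
  let f : Fin N → (MvPolynomial (Fin N) ℂ)[X] := fun k => X ^ y k * (1 - X) ^ (k : ℕ)
  refine ⟨(Matrix.of fun i k : Fin N => (newtonQuotient x (f k) i).eval (x i)).det, ?_, ?_⟩
  · intro w hw
    have h := congrArg (MvPolynomial.eval w) (det_eval_eq_prod_mul x f)
    have hne : ∏ j : Fin N, ∏ k ∈ Finset.Ioi j, (w j - w k) ≠ 0 := by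
      refine Finset.prod_ne_zero_iff.2 fun j _ => Finset.prod_ne_zero_iff.2 fun k hk => ?_
      exact sub_ne_zero.2 (hw.ne (Finset.mem_Ioi.1 hk).ne)
    rw [alternantRatio, div_eq_iff hne, mul_comm]
    simp only [map_mul, map_prod, map_sub, hx, MvPolynomial.eval_X] at h ⊢
    rw [← h, RingHom.map_det]
    congr 1
    ext j k
    simp [alternant, f]
  · rw [RingHom.map_det]
    have hx1 : ∀ m, MvPolynomial.eval (fun _ => 1) (x m) = 1 := fun m => by
      simp only [x]; split_ifs <;> simp
    have hent : ∀ i k : Fin N, i ≤ k →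
        MvPolynomial.eval (fun _ => 1) ((newtonQuotient x (f k) i).eval (x i)) =
          0 ^ ((k : ℕ) - i) := by
      intro i k hik
      rw [← Polynomial.eval_map_apply, newtonQuotient_map]
      simp only [hx1, f, Polynomial.map_mul, Polynomial.map_pow, Polynomial.map_sub,
        Polynomial.map_X, Polynomial.map_one]
      rw [newtonQuotient_one _ _ _ hik]
      simp
    rw [Matrix.det_of_isLowerTriangular]
    · exact Finset.prod_eq_one fun i _ => (hent i i le_rfl).trans (by simp)
    · intro i k hik
      have hik : i < k := hik
      exact (hent i k hik.le).trans (zero_pow (Nat.sub_ne_zero_of_lt hik))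

theorem exists_tendsto_alternantRatio {N : ℕ} (y : Fin N → ℕ) (z : Fin N → ℂ) :
    ∃ L, Tendsto (alternantRatio y) (𝓝[{w | Function.Injective w}] z) (𝓝 L) := by
  obtain ⟨P, hP, -⟩ := exists_alternantRatio_eq_eval y
  refine ⟨MvPolynomial.eval z P, Tendsto.congr' ?_
    ((MvPolynomial.continuous_eval P).continuousWithinAt (s := {w | Function.Injective w}))⟩
  filter_upwards [self_mem_nhdsWithin] with w hw using (hP w hw).symm

theorem tendsto_alternantRatio_one {N : ℕ} (y : Fin N → ℕ) :
    Tendsto (alternantRatio y) (𝓝[{w | Function.Injective w}] fun _ => 1) (𝓝 1) := by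
  obtain ⟨P, hP, h1⟩ := exists_alternantRatio_eq_eval y
  have h := (MvPolynomial.continuous_eval P).continuousWithinAt (s := {w | Function.Injective w})
    (x := fun _ => 1)
  rw [ContinuousWithinAt, h1] at h
  refine Tendsto.congr' ?_ h
  filter_upwards [self_mem_nhdsWithin] with w hw using (hP w hw).symm

/-! ### Counting configurations in the limit at `(1, …, 1)` -/

theorem card_vacantTuples_add (M N : ℕ) (l : ℤ) (d n : ℕ) :
    (vacantTuples M (N + 1) (l + d) n).card = (vacantTuples M (N + 1) l n).card := by
  induction d with
  | zero => simp
  | succ d ih =>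
    have h := sum_vacantTuples_rotate M N (l + d) n fun _ => 1
    simp only [Finset.sum_const, smul_eq_mul, mul_one] at h
    rw [Nat.cast_succ, ← add_assoc, ← h, ih]

theorem tendsto_sum_alternantRatio_one {N : ℕ} (s : Finset (Fin N → ℕ)) :
    Tendsto (fun w => ∑ y ∈ s, alternantRatio y w)
      (𝓝[{w | Function.Injective w}] fun _ => 1) (𝓝 s.card) := by
  have h := tendsto_finsetSum s fun y _ => tendsto_alternantRatio_one y
  simpa using h

theorem tendsto_determinantSide_one {M N : ℕ} (d : ℕ) {n : ℕ} (hn : n ≤ M) :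
    Tendsto (fun w : Fin (N + 1) → ℂ => determinantSide M (1 + d) n w)
      (𝓝[{w | Function.Injective w}] fun _ => 1) (𝓝 (vacantTuples M (N + 1) (1 + d) n).card) := by
  have h1 : Tendsto (fun w : Fin (N + 1) → ℂ => (∏ j, w j) ^ d)
      (𝓝[{w | Function.Injective w}] fun _ => 1) (𝓝 1) := by
    have hc : Continuous fun w : Fin (N + 1) → ℂ => (∏ j, w j) ^ d := by fun_prop
    simpa using (hc.tendsto fun _ => 1).mono_left nhdsWithin_le_nhds
  have h2 := h1.mul (tendsto_sum_alternantRatio_one (vacantTuples M (N + 1) 1 n))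
  rw [one_mul, ← card_vacantTuples_add M N 1 d n] at h2
  refine h2.congr' ?_
  -- The Bethe equations are not available near `(1, …, 1)`; shifting the integer powers in
  -- `determinantSide` only needs nonzero coordinates, which hold there.
  have h0 : ∀ᶠ w : Fin (N + 1) → ℂ in 𝓝[{w | Function.Injective w}] fun _ => 1,
      ∀ j, w j ≠ 0 := by
    refine eventually_all.2 fun j => nhdsWithin_le_nhds ?_
    exact (continuous_apply j).continuousAt.eventually_ne one_ne_zero
  filter_upwards [h0] with w hw
  rw [determinantSide_add _ _ _ _ hw, sum_alternantRatio le_rfl (by simp) hn]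

end VacancyTASEP

theorem mainTheorem11 (M N : ℕ) [NeZero M] (hN : 1 ≤ N) (hNM : N ≤ M)
    (l : ℤ) (n : ℕ) (hl : 1 - l ≤ (n : ℤ)) (hn : n ≤ M) :
    -- the formula, for pairwise distinct complex numbers
    (∀ z : Fin N → ℂ, Function.Injective z →
      (l ≤ 1 ∨ VacancyTASEP.BetheEquations M z) →
        VacancyTASEP.formFactorSum (VacancyTASEP.vacancyString M l n) z =
          VacancyTASEP.determinantSide M l n z) ∧
    -- the formula where some of the numbers may coincide: both sides extend by continuity
    -- from the points with pairwise distinct coordinates, and to the same value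
    (∀ z : Fin N → ℂ, (l ≤ 1 ∨ ∀ j, z j = 1) →
      ∃ L : ℂ,
        Tendsto (fun w : Fin N → ℂ =>
            VacancyTASEP.formFactorSum (VacancyTASEP.vacancyString M l n) w)
          (𝓝[{w | Function.Injective w}] z) (𝓝 L) ∧
        Tendsto (fun w : Fin N → ℂ => VacancyTASEP.determinantSide M l n w)
          (𝓝[{w | Function.Injective w}] z) (𝓝 L)) := by
  obtain ⟨N, rfl⟩ := Nat.exists_eq_add_of_le' hN
  have hsum := VacancyTASEP.formFactorSum_eq hN hNM l n
  constructor
  · intro z hz hlz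
    rw [hsum]
    rcases le_or_gt l 1 with h | h
    · exact VacancyTASEP.sum_alternantRatio h hl hn z
    · obtain ⟨d, hd⟩ := Int.le.dest h.le
      rw [← hd]
      exact (hlz.resolve_left (not_le.2 h)).sum_alternantRatio hz d hn
  · intro z hlz
    simp only [hsum]
    rcases le_or_gt l 1 with h | h
    · choose L hL using fun y => VacancyTASEP.exists_tendsto_alternantRatio (N := N + 1) y z
      have ht := tendsto_finsetSum (VacancyTASEP.vacantTuples M (N + 1) l n) fun y _ => hL y
      refine ⟨_, ht, ?_⟩
      -- For `l ≤ 1` the two sides agree pointwise, so they share the limit.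
      simpa only [VacancyTASEP.sum_alternantRatio h hl hn] using ht
    · obtain ⟨d, hd⟩ := Int.le.dest h.le
      obtain rfl : z = fun _ => 1 := funext (hlz.resolve_left (not_le.2 h))
      rw [← hd]
      exact ⟨_, VacancyTASEP.tendsto_sum_alternantRatio_one _,
        VacancyTASEP.tendsto_determinantSide_one d hn⟩
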